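/- Let $D=(V,E)$ be a finite simple digraph (no loops, no multiple arcs; opposite arcs are allowed) with at least one vertex, and let $A=A(D)$ be its adjacency matrix: $a_{ij}=1$ if $(i,j)\in E$ and $a_{ij}=0$ otherwise. The complementarity spectrum $\Pi(D)$ of $D$ is the set of all $\lambda\in\mathbb{R}$ for which there is a vector $x\in\mathbb{R}^V$ with $x\neq 0$, $x\ge 0$, $Ax\ge\lambda x$ (all inequalities coordinatewise) and $\langle x, Ax-\lambda x\rangle=0$. A cycle means a directed cycle, $D$ is called acyclic if it contains no cycle as a subdigraph, and each strongly connected component of $D$ is identified with the subdigraph that its vertices induce. 1. The following three statements are equivalent: (i) $\Pi(D)=\{0\}$; (ii) $\#\Pi(D)=1$; (iii) $D$ is acyclic. 2. The following three statements are equivalent: (i) $\Pi(D)=\{0,1\}$; (ii) $\#\Pi(D)=2$; (iii) $D$ is not acyclic and each of its strongly connected components is either a cycle or an isolated vertex (a single vertex with no arcs inside the component). -/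

import Mathlib

/-- The complementarity spectrum of a real square matrix `A`: the set of real `μ` for which there
is a nonzero, entrywise nonnegative vector `x` with `A x ≥ μ x` and `⟨x, A x - μ x⟩ = 0`. -/
def Matrix.complementaritySpectrum {V : Type*} [Fintype V] (A : Matrix V V ℝ) : Set ℝ :=
  {μ | ∃ x : V → ℝ, x ≠ 0 ∧ 0 ≤ x ∧ μ • x ≤ A.mulVec x ∧ x ⬝ᵥ (A.mulVec x - μ • x) = 0}

namespace Digraph

/-- A digraph is simple if it has no loops (a `Digraph` never has multiple arcs). -/
def IsSimple {V : Type*} (D : Digraph V) : Prop :=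
  ∀ v, ¬ D.Adj v v

open Classical in
/-- The real adjacency matrix: the entry `(i, j)` is `1` if `(i, j)` is an arc, `0` otherwise. -/
noncomputable def adjacencyMatrix {V : Type*} (D : Digraph V) : Matrix V V ℝ :=
  Matrix.of fun i j => if D.Adj i j then 1 else 0

/-- The complementarity spectrum of a digraph. -/
noncomputable def complementaritySpectrum {V : Type*} [Fintype V] (D : Digraph V) : Set ℝ :=
  D.adjacencyMatrix.complementaritySpectrum

/-- The directed cycle `0 → 1 → ⋯ → n - 1 → 0` on `n` vertices
(for `n = 1` it is a loop, which no simple digraph contains). -/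
def dicycle (n : ℕ) : Digraph (Fin n) where
  Adj i j := (j : ℕ) = ((i : ℕ) + 1) % n

/-- A digraph is a (directed) cycle if it is isomorphic to `dicycle n` for some `n ≥ 1`. -/
def IsDicycle {V : Type*} (D : Digraph V) : Prop :=
  ∃ n : ℕ, 1 ≤ n ∧ Nonempty ((dicycle n).Adj ≃r D.Adj)

/-- A digraph is acyclic if it contains no directed cycle as a (not necessarily induced)
subdigraph. -/
def IsAcyclic {V : Type*} (D : Digraph V) : Prop :=
  ¬ ∃ n : ℕ, 1 ≤ n ∧ ∃ f : Fin n → V, Function.Injective f ∧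
    ∀ i j, (dicycle n).Adj i j → D.Adj (f i) (f j)

/-- A digraph is an isolated vertex if it has exactly one vertex and no arcs. -/
def IsIsolatedVertex {V : Type*} (D : Digraph V) : Prop :=
  (∃ v : V, ∀ w : V, w = v) ∧ ∀ v w : V, ¬ D.Adj v w

/-- The subdigraph induced by a set of vertices. -/
def induced {V : Type*} (D : Digraph V) (S : Set V) : Digraph S where
  Adj v w := D.Adj v w

/-- There is a directed walk (possibly of length `0`) from `v` to `w`. -/
def Reaches {V : Type*} (D : Digraph V) (v w : V) : Prop :=
  Relation.ReflTransGen D.Adj v w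

/-- `S` is the vertex set of a strongly connected component of `D`: a class of the equivalence
relation "there are directed walks from `v` to `w` and from `w` to `v`". -/
def IsStrongComponent {V : Type*} (D : Digraph V) (S : Set V) : Prop :=
  ∃ v : V, S = {w | D.Reaches v w ∧ D.Reaches w v}

end Digraph

/-! A nonzero complementarity eigenvalue has a vector whose support `S` is sinkless, and a finite
digraph has a nonempty sinkless set exactly when it has a cycle; so acyclic digraphs have only 0.
The indicator of a minimal sinkless set realizes 1 as soon as there is a cycle.

It remains to decide when other values occur. If no vertex has two out-neighbours in its strong
component, comparing extreme entries on a terminal part of the support forces the value 1. Otherwise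
some component is neither a cycle nor a vertex; its Perron root exceeds 1, and extending the Perron
vector by zero puts that root into the spectrum. -/

open Matrix in
/-- Perron's theorem: a nonnegative matrix with strongly connected support has an entrywise
positive eigenvector for a nonnegative eigenvalue. -/
theorem Matrix.exists_pos_eigenvector {n : Type*} [Fintype n] [DecidableEq n] [Nonempty n]
    (A : Matrix n n ℝ) (hA : ∀ i j, 0 ≤ A i j) (hpow : ∀ i j, ∃ k : ℕ, 0 < (A ^ k) i j) :
    ∃ (r : ℝ) (x : n → ℝ), 0 ≤ r ∧ (∀ i, 0 < x i) ∧ A *ᵥ x = r • x := by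
  classical
  set M : ℝ := ∑ i, ∑ j, A i j with hM
  have hbound : ∀ (r : ℝ) (x : n → ℝ), x ∈ stdSimplex ℝ n → r • x ≤ A *ᵥ x → r ≤ M := by
    intro r x hx h
    calc r = ∑ i, (r • x) i := by simp [← Finset.mul_sum, hx.2]
      _ ≤ ∑ i, (A *ᵥ x) i := Finset.sum_le_sum fun i _ => h i
      _ ≤ M := by
        refine Finset.sum_le_sum fun i _ => Finset.sum_le_sum fun j _ => ?_
        have hx1 : x j ≤ 1 := by
          rw [← hx.2]; exact Finset.single_le_sum (fun k _ => hx.1 k) (Finset.mem_univ j)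
        exact mul_le_of_le_one_right (hA i j) hx1
  have hmul : ∀ x : n → ℝ, 0 ≤ x → 0 ≤ A *ᵥ x := fun x hx i =>
    Finset.sum_nonneg fun j _ => mul_nonneg (hA i j) (hx j)
  -- Collatz–Wielandt: the largest `r` with `r • x ≤ A *ᵥ x` for some `x` in the simplex exists by
  -- compactness.
  set K : Set (ℝ × (n → ℝ)) :=
    (Set.Icc 0 M ×ˢ stdSimplex ℝ n) ∩ {p | p.1 • p.2 ≤ A *ᵥ p.2} with hK
  have hKc : IsCompact K := by
    refine (isCompact_Icc.prod (isCompact_stdSimplex ℝ n)).inter_right ?_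
    exact isClosed_le (by fun_prop) (Continuous.matrix_mulVec continuous_const continuous_snd)
  have hKn : K.Nonempty := by
    obtain ⟨i⟩ := ‹Nonempty n›
    have hs := single_mem_stdSimplex ℝ i
    have h0 : (0 : ℝ) • Pi.single i (1 : ℝ) ≤ A *ᵥ Pi.single i (1 : ℝ) := by
      rw [zero_smul]; exact hmul _ hs.1
    exact ⟨(0, Pi.single i 1), ⟨⟨le_rfl, hbound _ _ hs h0⟩, hs⟩, h0⟩
  obtain ⟨⟨r, x⟩, ⟨⟨⟨hr0, -⟩, hx⟩, hrx⟩, hmax⟩ := hKc.exists_isMaxOn hKn continuous_fst.continuousOn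
  have hmax' : ∀ (s : ℝ) (y : n → ℝ), 0 ≤ s → (∀ i, 0 < y i) → s • y ≤ A *ᵥ y → s ≤ r := by
    intro s y hs hy hsy
    have hsum : 0 < ∑ i, y i := Finset.sum_pos (fun i _ => hy i) Finset.univ_nonempty
    have hc : 0 ≤ (∑ i, y i)⁻¹ := (inv_pos.2 hsum).le
    have hmem : (∑ i, y i)⁻¹ • y ∈ stdSimplex ℝ n := by
      refine ⟨fun i => mul_nonneg hc (hy i).le, ?_⟩
      simp only [Pi.smul_apply, smul_eq_mul, ← Finset.mul_sum]
      exact inv_mul_cancel₀ hsum.ne'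
    have hle : s • ((∑ i, y i)⁻¹ • y) ≤ A *ᵥ ((∑ i, y i)⁻¹ • y) := by
      rw [mulVec_smul, smul_comm]
      exact smul_le_smul_of_nonneg_left hsy hc
    exact hmax (show (s, _) ∈ K from ⟨⟨⟨hs, hbound _ _ hmem hle⟩, hmem⟩, hle⟩)
  choose k hk using hpow
  -- `B` is entrywise positive and commutes with `A`, so it turns any nonzero slack in `r • x ≤ A *ᵥ
  -- x` into strict slack at every entry.
  set B : Matrix n n ℝ := ∑ i, ∑ j, A ^ k i j with hB
  have hpownn : ∀ m i j, 0 ≤ (A ^ m) i j := fun m i j => pow_apply_nonneg hA m i j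
  have hBpos : ∀ i j, 0 < B i j := by
    intro i j
    have : B i j = ∑ a, ∑ b, (A ^ k a b) i j := by simp [hB, Matrix.sum_apply]
    rw [this]
    refine Finset.sum_pos' (fun a _ => Finset.sum_nonneg fun b _ => hpownn _ _ _)
      ⟨i, Finset.mem_univ i, Finset.sum_pos' (fun b _ => hpownn _ _ _)
        ⟨j, Finset.mem_univ j, hk i j⟩⟩
  have hcomm : A * B = B * A := by
    simp only [hB, Finset.mul_sum, Finset.sum_mul, (Commute.self_pow A _).eq]
  have hBmul : ∀ z : n → ℝ, 0 ≤ z → z ≠ 0 → ∀ i, 0 < (B *ᵥ z) i := by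
    intro z hz hz0 i
    obtain ⟨j, hj⟩ := Function.ne_iff.1 hz0
    exact Finset.sum_pos' (fun j _ => mul_nonneg (hBpos i j).le (hz j))
      ⟨j, Finset.mem_univ j, mul_pos (hBpos i j) (lt_of_le_of_ne (hz j) (Ne.symm hj))⟩
  have hx0 : x ≠ 0 := by
    rintro rfl
    simpa using hx.2
  set y := B *ᵥ x with hy
  have hypos := hBmul x hx.1 hx0
  have hAy : A *ᵥ y = r • y + B *ᵥ (A *ᵥ x - r • x) := by
    rw [hy, mulVec_sub, mulVec_smul, mulVec_mulVec, mulVec_mulVec, hcomm]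
    abel
  by_cases hz : A *ᵥ x - r • x = 0
  · exact ⟨r, y, hr0, hypos, by rw [hAy, hz, mulVec_zero, add_zero]⟩
  · exfalso
    have hzpos := hBmul _ (sub_nonneg.2 hrx) hz
    -- The strict slack lets `r` grow by the least ratio `z i / y i`, against maximality.
    set z := B *ᵥ (A *ᵥ x - r • x)
    obtain ⟨i, -, hi⟩ := Finset.exists_min_image Finset.univ (fun i => z i / y i)
      Finset.univ_nonempty
    have hε : 0 < z i / y i := div_pos (hzpos i) (hypos i)
    have := hmax' (r + z i / y i) y (by positivity) hypos (by
      rw [hAy, add_smul]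
      refine add_le_add le_rfl fun j => ?_
      have := hi j (Finset.mem_univ j)
      exact (le_div_iff₀ (hypos j)).1 this)
    linarith

/-! ### Complementarity eigenvectors and their supports -/

/-- Entrywise form of membership in the complementarity spectrum. -/
theorem Matrix.mem_complementaritySpectrum_iff {V : Type*} [Fintype V] {A : Matrix V V ℝ} {μ : ℝ} :
    μ ∈ A.complementaritySpectrum ↔ ∃ x : V → ℝ, x ≠ 0 ∧ 0 ≤ x ∧ μ • x ≤ A.mulVec x ∧
      ∀ v, x v ≠ 0 → A.mulVec x v = μ * x v := by
  unfold complementaritySpectrum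
  refine exists_congr fun x => and_congr_right fun _ => and_congr_right fun hx =>
    and_congr_right fun hle => ?_
  rw [dotProduct, Finset.sum_eq_zero_iff_of_nonneg
    fun v _ => mul_nonneg (hx v) (show 0 ≤ (A.mulVec x - μ • x) v from sub_nonneg.2 (hle v))]
  simp [sub_eq_zero, or_iff_not_imp_left]

namespace Digraph

variable {V : Type*}

/-- Every vertex of `S` has an out-neighbour in `S`. -/
def IsSinkless (D : Digraph V) (S : Set V) : Prop :=
  ∀ v ∈ S, ∃ w ∈ S, D.Adj v w

open Classical in
theorem adjacencyMatrix_mulVec_apply [Fintype V] (D : Digraph V) (x : V → ℝ) (v : V) :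
    D.adjacencyMatrix.mulVec x v = ∑ w, if D.Adj v w then x w else 0 := by
  simp [adjacencyMatrix, Matrix.mulVec, dotProduct]

theorem adjacencyMatrix_nonneg (D : Digraph V) (v w : V) : 0 ≤ D.adjacencyMatrix v w := by
  simp only [adjacencyMatrix, Matrix.of_apply]
  split_ifs <;> norm_num

theorem adjacencyMatrix_mulVec_nonneg [Fintype V] (D : Digraph V) {x : V → ℝ} (hx : 0 ≤ x) :
    0 ≤ D.adjacencyMatrix.mulVec x := fun v =>
  Finset.sum_nonneg fun w _ => mul_nonneg (D.adjacencyMatrix_nonneg v w) (hx w)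

theorem adjacencyMatrix_mulVec_apply_of_unique [Fintype V] (D : Digraph V) {x : V → ℝ} {v w : V}
    (hvw : D.Adj v w) (h : ∀ u, D.Adj v u → x u ≠ 0 → u = w) :
    D.adjacencyMatrix.mulVec x v = x w := by
  classical
  rw [adjacencyMatrix_mulVec_apply, Finset.sum_eq_single w]
  · simp [hvw]
  · intro u _ huw
    by_contra hne
    simp only [ite_eq_right_iff, not_forall] at hne
    exact huw (h u hne.1 hne.2)
  · simp

theorem zero_mem_complementaritySpectrum [Fintype V] [Nonempty V] (D : Digraph V)
    (hD : D.IsSimple) : 0 ∈ D.complementaritySpectrum := by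
  classical
  obtain ⟨v⟩ := ‹Nonempty V›
  have h1 : (0 : V → ℝ) ≤ Pi.single v 1 := Pi.single_nonneg.2 zero_le_one
  refine Matrix.mem_complementaritySpectrum_iff.2 ⟨Pi.single v 1, by simp, h1, ?_, ?_⟩
  · rw [zero_smul]; exact D.adjacencyMatrix_mulVec_nonneg h1
  · intro w hw
    obtain rfl : w = v := by
      by_contra h
      exact hw (Pi.single_eq_of_ne h 1)
    simp [adjacencyMatrix, hD w]

/-- The support of a vector realizing a nonzero complementarity eigenvalue is sinkless. -/
theorem isSinkless_support [Fintype V] (D : Digraph V) {μ : ℝ} (hμ : μ ≠ 0) {x : V → ℝ}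
    (h : ∀ v, x v ≠ 0 → D.adjacencyMatrix.mulVec x v = μ * x v) :
    D.IsSinkless {v | x v ≠ 0} := by
  classical
  intro v hv
  have hne : D.adjacencyMatrix.mulVec x v ≠ 0 := by
    rw [h v hv]; exact mul_ne_zero hμ hv
  rw [adjacencyMatrix_mulVec_apply] at hne
  obtain ⟨w, -, hw⟩ := Finset.exists_ne_zero_of_sum_ne_zero hne
  simp only [ne_eq, ite_eq_right_iff, not_forall] at hw
  exact ⟨w, hw.2, hw.1⟩

/-! ### Sinkless sets, cycles and the eigenvalue 1 -/

/-- The orbit of a periodic point is a directed cycle in any digraph along which the map moves. -/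
theorem dicycle_adj_iff_iterate {f : V → V} {v : V}
    (hv : v ∈ Function.periodicPts f) (i j : Fin (Function.minimalPeriod f v)) :
    (dicycle _).Adj i j ↔ f^[j] v = f (f^[i] v) := by
  have hp := Function.minimalPeriod_pos_of_mem_periodicPts hv
  rw [← Function.iterate_succ_apply' f, ← Function.iterate_mod_minimalPeriod_eq (n := i.1.succ),
    Function.iterate_eq_iterate_iff_of_lt_minimalPeriod j.2 (Nat.mod_lt _ hp)]
  rfl

/-- Choosing an out-neighbour inside `S` gives a self-map of a finite set; it has a periodic point,
whose orbit is a cycle. -/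
theorem not_isAcyclic_of_isSinkless [Finite V] (D : Digraph V) {S : Set V} (hS : S.Nonempty)
    (h : D.IsSinkless S) : ¬ D.IsAcyclic := by
  rw [IsAcyclic, not_not]
  have h' : ∀ v : S, ∃ w : S, D.Adj v w := fun v =>
    let ⟨w, hw, hvw⟩ := h v v.2
    ⟨⟨w, hw⟩, hvw⟩
  choose f hf using h'
  obtain ⟨v⟩ := hS.to_subtype
  obtain ⟨a, b, hab, heq⟩ := Finite.exists_ne_map_eq_of_infinite fun k : ℕ => f^[k] v
  obtain ⟨u, hu⟩ : ∃ u, u ∈ Function.periodicPts f := by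
    wlog hlt : a < b generalizing a b
    · exact this b a hab.symm heq.symm (by omega)
    refine ⟨f^[a] v, Function.mk_mem_periodicPts (Nat.sub_pos_of_lt hlt) ?_⟩
    rw [Function.IsPeriodicPt, Function.IsFixedPt, ← Function.iterate_add_apply,
      Nat.sub_add_cancel hlt.le]
    exact heq.symm
  refine ⟨_, Function.minimalPeriod_pos_of_mem_periodicPts hu, fun i => (f^[i] u : S), ?_, ?_⟩
  · intro i j hij
    exact Fin.ext ((Function.iterate_eq_iterate_iff_of_lt_minimalPeriod i.2 j.2).1
      (Subtype.ext hij))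
  · intro i j hij
    have := (dicycle_adj_iff_iterate hu i j).1 hij
    simpa only [this] using hf (f^[i] u)

theorem isAcyclic_iff_forall_not_isSinkless [Finite V] (D : Digraph V) :
    D.IsAcyclic ↔ ∀ S : Set V, S.Nonempty → ¬ D.IsSinkless S := by
  refine ⟨fun h S hS hS' => D.not_isAcyclic_of_isSinkless hS hS' h, ?_⟩
  rintro h ⟨n, hn, f, -, hf⟩
  refine h (Set.range f) ⟨f ⟨0, hn⟩, Set.mem_range_self _⟩ ?_
  rintro _ ⟨i, rfl⟩
  exact ⟨_, Set.mem_range_self ⟨(i + 1) % n, Nat.mod_lt _ hn⟩, hf _ _ (by simp [dicycle])⟩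

/-- In a minimal nonempty sinkless set every vertex has at most one out-neighbour. -/
theorem eq_of_adj_of_minimal_isSinkless [Finite V] (D : Digraph V) {S : Set V}
    (hS : Minimal (fun T : Set V => T.Nonempty ∧ D.IsSinkless T) S) {v w w' : V} (hv : v ∈ S)
    (hw : w ∈ S) (hw' : w' ∈ S) (hvw : D.Adj v w) (hvw' : D.Adj v w') : w = w' := by
  classical
  -- The range of such a choice map is itself sinkless, hence all of `S` by minimality.
  have hsurj : ∀ f : S → S, (∀ u : S, D.Adj u (f u)) → Function.Surjective f := by
    intro f hf
    have hmin : S ⊆ Subtype.val '' Set.range f := by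
      refine hS.2 ⟨⟨f ⟨v, hv⟩, _, ⟨_, rfl⟩, rfl⟩, ?_⟩ ?_
      · rintro _ ⟨_, ⟨u, rfl⟩, rfl⟩
        exact ⟨f (f u), ⟨_, ⟨_, rfl⟩, rfl⟩, hf _⟩
      · rintro _ ⟨u, -, rfl⟩
        exact u.2
    intro u
    obtain ⟨_, ⟨t, rfl⟩, ht⟩ := hmin u.2
    exact ⟨t, Subtype.ext ht⟩
  have h' : ∀ v : S, ∃ w : S, D.Adj v w := fun v =>
    let ⟨w, hw, hvw⟩ := hS.1.2 v v.2
    ⟨⟨w, hw⟩, hvw⟩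
  choose f hf using h'
  -- Two bijective choice maps that agree off `v` must agree at `v` as well.
  have hupd : ∀ t : S, D.Adj v t → ∀ u : S, D.Adj u (Function.update f ⟨v, hv⟩ t u) := by
    intro t ht u
    by_cases hu : u = ⟨v, hv⟩
    · subst hu; simpa using ht
    · simpa [hu] using hf u
  have h1 := hsurj _ (hupd ⟨w, hw⟩ hvw)
  have h2 := Finite.injective_iff_surjective.2 (hsurj _ (hupd ⟨w', hw'⟩ hvw'))
  obtain ⟨u, hu⟩ := h1 ⟨w', hw'⟩
  by_cases huv : u = ⟨v, hv⟩
  · subst huv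
    simpa using hu
  · refine absurd (@h2 u ⟨v, hv⟩ ?_) huv
    simpa [huv] using hu

theorem one_mem_complementaritySpectrum [Fintype V] (D : Digraph V) (h : ¬ D.IsAcyclic) :
    1 ∈ D.complementaritySpectrum := by
  classical
  rw [isAcyclic_iff_forall_not_isSinkless] at h
  push Not at h
  obtain ⟨T, hT⟩ := h
  obtain ⟨S, -, hS⟩ := (Set.toFinite {T : Set V | T.Nonempty ∧ D.IsSinkless T}).exists_le_minimal hT
  have hnn : (0 : V → ℝ) ≤ S.indicator 1 := Set.indicator_nonneg fun _ _ => zero_le_one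
  have hval : ∀ v ∈ S, D.adjacencyMatrix.mulVec (S.indicator 1) v = 1 := by
    intro v hv
    obtain ⟨w, hw, hvw⟩ := hS.1.2 v hv
    rw [D.adjacencyMatrix_mulVec_apply_of_unique hvw, Set.indicator_of_mem hw, Pi.one_apply]
    intro u hvu hu
    exact D.eq_of_adj_of_minimal_isSinkless hS hv (Set.mem_of_indicator_ne_zero hu) hw hvu hvw
  refine Matrix.mem_complementaritySpectrum_iff.2 ⟨S.indicator 1, ?_, hnn, ?_, ?_⟩
  · obtain ⟨v, hv⟩ := hS.1.1
    exact fun h0 => by simpa [hv] using congrFun h0 v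
  · intro v
    rw [one_smul]
    by_cases hv : v ∈ S
    · rw [hval v hv]; simp [hv]
    · rw [Set.indicator_of_notMem hv]
      exact D.adjacencyMatrix_mulVec_nonneg hnn v
  · intro v hv
    have hv := Set.mem_of_indicator_ne_zero hv
    rw [hval v hv]; simp [hv]

theorem complementaritySpectrum_eq_singleton_zero_iff [Fintype V] [Nonempty V] (D : Digraph V)
    (hD : D.IsSimple) : D.complementaritySpectrum = {0} ↔ D.IsAcyclic := by
  constructor
  · intro h
    by_contra hc
    have := D.one_mem_complementaritySpectrum hc
    rw [h] at this
    exact one_ne_zero this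
  · intro h
    refine Set.Subset.antisymm (fun μ hμ => ?_)
      (Set.singleton_subset_iff.2 (D.zero_mem_complementaritySpectrum hD))
    obtain ⟨x, hx0, -, -, hx⟩ := Matrix.mem_complementaritySpectrum_iff.1 hμ
    by_contra hne
    exact D.isAcyclic_iff_forall_not_isSinkless.1 h _ (Function.ne_iff.1 hx0)
      (D.isSinkless_support hne hx)

/-! ### No eigenvalues besides 0 and 1 -/

/-- If no vertex has two out-neighbours in its strong component, then the only possible nonzero
complementarity eigenvalue is `1`. -/
theorem complementaritySpectrum_subset_of_unique [Fintype V] (D : Digraph V)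
    (h : ∀ v w w', D.Adj v w → D.Adj v w' → D.Reaches w v → D.Reaches w' v → w = w') :
    D.complementaritySpectrum ⊆ {0, 1} := by
  classical
  intro μ hμ
  obtain ⟨x, hx0, hxnn, -, hx⟩ := Matrix.mem_complementaritySpectrum_iff.1 hμ
  by_cases hμ0 : μ = 0
  · exact Or.inl hμ0
  right
  have hsl := D.isSinkless_support hμ0 hx
  -- A minimal nonempty set of vertices of the support that is closed under arcs in the support.
  let P : Set V → Prop := fun T => T.Nonempty ∧ (∀ v ∈ T, x v ≠ 0) ∧
    ∀ v ∈ T, ∀ w, D.Adj v w → x w ≠ 0 → w ∈ T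
  have hP : P {v | x v ≠ 0} := ⟨Function.ne_iff.1 hx0, fun _ hv => hv, fun _ _ _ _ hw => hw⟩
  obtain ⟨K, -, hK⟩ := (Set.toFinite {T : Set V | P T}).exists_le_minimal hP
  -- The part of `K` reachable from `v` has the same closure property, so minimality makes it all of
  -- `K`.
  have hreach : ∀ v ∈ K, ∀ w ∈ K, D.Reaches v w := by
    intro v hv
    have : K ⊆ {w | w ∈ K ∧ D.Reaches v w} := by
      refine hK.2 ⟨⟨v, hv, .refl⟩, fun w hw => hK.1.2.1 w hw.1, ?_⟩ fun w hw => hw.1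
      exact fun w hw u hwu hu => ⟨hK.1.2.2 w hw.1 u hwu hu, hw.2.tail hwu⟩
    exact fun w hw => (this hw).2
  have hstep : ∀ v ∈ K, ∃ w ∈ K, x w = μ * x v := by
    intro v hv
    obtain ⟨w, hw, hvw⟩ := hsl v (hK.1.2.1 v hv)
    have hwK := hK.1.2.2 v hv w hvw hw
    refine ⟨w, hwK, ?_⟩
    rw [← hx v (hK.1.2.1 v hv), D.adjacencyMatrix_mulVec_apply_of_unique hvw]
    intro u hvu hu
    exact h v u w hvu hvw (hreach u (hK.1.2.2 v hv u hvu hu) v hv) (hreach w hwK v hv)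
  have hpos : ∀ v ∈ K, 0 < x v := fun v hv => lt_of_le_of_ne (hxnn v) (hK.1.2.1 v hv).symm
  -- The step from a maximal entry gives `μ ≤ 1`, the step from a minimal one `1 ≤ μ`.
  obtain ⟨a, ha, hmax⟩ := Set.exists_max_image K x K.toFinite hK.1.1
  obtain ⟨b, hb, hmin⟩ := Set.exists_min_image K x K.toFinite hK.1.1
  obtain ⟨a', ha', haa⟩ := hstep a ha
  obtain ⟨b', hb', hbb⟩ := hstep b hb
  have h1 := hmax a' ha'
  have h2 := hmin b' hb'
  rw [haa] at h1
  rw [hbb] at h2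
  exact le_antisymm (by simpa using (mul_le_iff_le_one_left (hpos a ha)).1 h1)
    (by simpa using (le_mul_iff_one_le_left (hpos b hb)).1 h2)

theorem IsDicycle.eq_of_adj {D : Digraph V} (hD : D.IsDicycle) {v w w' : V}
    (h : D.Adj v w) (h' : D.Adj v w') : w = w' := by
  obtain ⟨n, -, ⟨e⟩⟩ := hD
  have h1 : (dicycle n).Adj (e.symm v) (e.symm w) := e.symm.map_rel_iff.2 h
  have h2 : (dicycle n).Adj (e.symm v) (e.symm w') := e.symm.map_rel_iff.2 h'
  exact e.symm.injective (Fin.ext (h1.trans h2.symm))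

/-! ### Perron roots greater than 1 -/

/-- A strongly connected finite digraph with all outdegrees equal to `1` is a directed cycle. -/
theorem isDicycle_of_existsUnique [Finite V] [Nonempty V] (D : Digraph V)
    (hconn : ∀ v w, D.Reaches v w) (h : ∀ v, ∃! w, D.Adj v w) : D.IsDicycle := by
  choose f hf hf' using h
  have hadj : ∀ v w, D.Adj v w ↔ w = f v := fun v w => ⟨hf' v w, fun h => h ▸ hf v⟩
  have hiter : ∀ v w, ∃ k : ℕ, f^[k] v = w := by
    intro v w
    induction hconn v w with
    | refl => exact ⟨0, rfl⟩
    | tail _ h ih =>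
      obtain ⟨k, rfl⟩ := ih
      exact ⟨k + 1, by rw [Function.iterate_succ_apply', (hadj _ _).1 h]⟩
  obtain ⟨v⟩ := ‹Nonempty V›
  have hv : v ∈ Function.periodicPts f := by
    obtain ⟨k, hk⟩ := hiter (f v) v
    exact Function.mk_mem_periodicPts k.succ_pos hk
  have hp := Function.minimalPeriod_pos_of_mem_periodicPts hv
  refine ⟨_, hp, ⟨⟨Equiv.ofBijective (fun i => f^[i] v) ⟨?_, ?_⟩, ?_⟩⟩⟩
  · intro i j hij
    exact Fin.ext ((Function.iterate_eq_iterate_iff_of_lt_minimalPeriod i.2 j.2).1 hij)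
  · intro w
    obtain ⟨k, rfl⟩ := hiter v w
    exact ⟨⟨k % _, Nat.mod_lt _ hp⟩, Function.iterate_mod_minimalPeriod_eq⟩
  · intro i j
    rw [hadj, dicycle_adj_iff_iterate hv]
    rfl

theorem exists_adjacencyMatrix_pow_pos [Fintype V] [DecidableEq V] (D : Digraph V) {v w : V}
    (h : D.Reaches v w) : ∃ k : ℕ, 0 < (D.adjacencyMatrix ^ k) v w := by
  induction h with
  | refl => exact ⟨0, by simp⟩
  | @tail u w _ huw ih =>
    obtain ⟨k, hk⟩ := ih
    refine ⟨k + 1, ?_⟩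
    rw [pow_succ, Matrix.mul_apply]
    refine Finset.sum_pos' (fun t _ => mul_nonneg
      (Matrix.pow_apply_nonneg D.adjacencyMatrix_nonneg k v t) (D.adjacencyMatrix_nonneg t w))
      ⟨u, Finset.mem_univ u, mul_pos hk ?_⟩
    simp [adjacencyMatrix, huw]

/-- A strongly connected simple digraph that is neither a cycle nor a vertex has a positive
eigenvector for some eigenvalue greater than `1`. -/
theorem exists_pos_eigenvector_one_lt [Fintype V] [Nonempty V] (D : Digraph V) (hD : D.IsSimple)
    (hconn : ∀ v w, D.Reaches v w) (hcycle : ¬ D.IsDicycle) (hisol : ¬ D.IsIsolatedVertex) :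
    ∃ (r : ℝ) (x : V → ℝ), 1 < r ∧ (∀ v, 0 < x v) ∧ D.adjacencyMatrix.mulVec x = r • x := by
  classical
  obtain ⟨r, x, -, hx, hr⟩ := D.adjacencyMatrix.exists_pos_eigenvector D.adjacencyMatrix_nonneg
    fun v w => D.exists_adjacencyMatrix_pow_pos (hconn v w)
  refine ⟨r, x, ?_, hx, hr⟩
  by_contra! hr1
  have hsum : ∀ v, ∑ w, (if D.Adj v w then x w else 0) ≤ x v := by
    intro v
    rw [← adjacencyMatrix_mulVec_apply, hr]
    exact mul_le_of_le_one_left (hx v).le hr1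
  have hsub : ∀ v (s : Finset V), (∀ w ∈ s, D.Adj v w) → ∑ w ∈ s, x w ≤ x v := by
    intro v s hs
    refine le_trans ?_ (hsum v)
    rw [← Finset.sum_filter]
    exact Finset.sum_le_sum_of_subset_of_nonneg (fun w hw => by simpa using hs w hw)
      fun w _ _ => (hx w).le
  -- With `r ≤ 1`, `x` cannot increase along arcs, so strong connectivity makes it constant; two
  -- out-neighbours would then give `2 * x v ≤ x v`.
  have hle : ∀ v w, x w ≤ x v := by
    intro v w
    induction hconn v w with
    | refl => exact le_rfl
    | @tail u w _ h ih => exact le_trans (by simpa using hsub u {w} (by simpa using h)) ih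
  have hout : ∀ v, ∃ w, D.Adj v w := by
    intro v
    by_contra! hv
    have hall : ∀ w, w = v := fun w => by
      rcases Relation.ReflTransGen.cases_head (hconn v w) with h | ⟨u, hu, -⟩
      · exact h.symm
      · exact absurd hu (hv u)
    exact hisol ⟨⟨v, hall⟩, fun a b hab => hD v (by rwa [hall a, hall b] at hab)⟩
  refine hcycle (D.isDicycle_of_existsUnique hconn fun v => ?_)
  obtain ⟨w, hw⟩ := hout v
  refine ⟨w, hw, fun u hu => ?_⟩
  by_contra hne
  have h2 := hsub v {u, w} (by rintro t ht; rcases Finset.mem_insert.1 ht with rfl | ht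
                               · exact hu
                               · rwa [Finset.mem_singleton.1 ht])
  rw [Finset.sum_pair hne] at h2
  linarith [hle u v, hx w]

/-! ### From strong components to the whole digraph -/

/-- Eigenvalues of induced subdigraphs with a positive eigenvector lie in the complementarity
spectrum. -/
theorem mem_complementaritySpectrum_of_induced [Fintype V] (D : Digraph V) (S : Set V) [Fintype S]
    [Nonempty S] {r : ℝ} {x : S → ℝ} (hx : ∀ v, 0 < x v)
    (h : (D.induced S).adjacencyMatrix.mulVec x = r • x) : r ∈ D.complementaritySpectrum := by
  classical
  -- Off `S` the extension vanishes, so only nonnegativity of its image is needed there.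
  set y : V → ℝ := fun v => if hv : v ∈ S then x ⟨v, hv⟩ else 0 with hy
  have hyS : ∀ v : S, y v = x v := fun v => by simp [hy]
  have hyn : ∀ v ∉ S, y v = 0 := fun v hv => by simp [hy, hv]
  have hnn : 0 ≤ y := fun v => by
    by_cases hv : v ∈ S
    · exact (hx ⟨v, hv⟩).le.trans_eq (hyS ⟨v, hv⟩).symm
    · exact (hyn v hv).ge
  have hval : ∀ v ∈ S, D.adjacencyMatrix.mulVec y v = r * y v := by
    intro v hv
    have := congrFun h ⟨v, hv⟩
    rw [Pi.smul_apply, smul_eq_mul, ← hyS, adjacencyMatrix_mulVec_apply] at this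
    rw [← this, adjacencyMatrix_mulVec_apply]
    symm
    refine Finset.sum_of_injOn Subtype.val Subtype.val_injective.injOn (by simp) ?_ ?_
    · intro w _ hw
      have : w ∉ S := fun hwS => hw ⟨⟨w, hwS⟩, by simp, rfl⟩
      simp [hyn w this]
    · intro w _
      simp only [hyS, induced]
      congr
  refine Matrix.mem_complementaritySpectrum_iff.2 ⟨y, ?_, hnn, ?_, ?_⟩
  · obtain ⟨v⟩ := ‹Nonempty S›
    exact fun h0 => (hx v).ne' ((hyS v).symm.trans (congrFun h0 v))
  · intro v
    by_cases hv : v ∈ S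
    · exact (hval v hv).ge
    · rw [Pi.smul_apply, hyn v hv, smul_zero]
      exact D.adjacencyMatrix_mulVec_nonneg hnn v
  · intro v hv
    by_cases hvS : v ∈ S
    · exact hval v hvS
    · exact absurd (hyn v hvS) hv

/-- A walk between two vertices of a component never leaves it. -/
theorem IsStrongComponent.reaches_induced {D : Digraph V} {S : Set V} (hS : D.IsStrongComponent S)
    (v w : S) : (D.induced S).Reaches v w := by
  obtain ⟨c, rfl⟩ := hS
  have key : ∀ a b : V, D.Reaches a b → ∀ (ha : D.Reaches c a ∧ D.Reaches a c)
      (hb : D.Reaches c b ∧ D.Reaches b c),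
      (D.induced {w | D.Reaches c w ∧ D.Reaches w c}).Reaches ⟨a, ha⟩ ⟨b, hb⟩ := by
    intro a b hab
    induction hab with
    | refl => exact fun _ _ => .refl
    | @tail u b hau hub ih =>
      intro ha hb
      exact (ih ha ⟨ha.1.trans hau, .head hub hb.2⟩).tail hub
  exact key v w (v.2.2.trans w.2.1) v.2 w.2

theorem complementaritySpectrum_eq_zero_one [Fintype V] [Nonempty V] (D : Digraph V)
    (hD : D.IsSimple) (hc : ¬ D.IsAcyclic)
    (h : ∀ S : Set V, D.IsStrongComponent S →
      (D.induced S).IsDicycle ∨ (D.induced S).IsIsolatedVertex) :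
    D.complementaritySpectrum = {0, 1} := by
  refine Set.Subset.antisymm (D.complementaritySpectrum_subset_of_unique ?_)
    (Set.insert_subset (D.zero_mem_complementaritySpectrum hD)
      (Set.singleton_subset_iff.2 (D.one_mem_complementaritySpectrum hc)))
  intro v w w' hw hw' hwv hwv'
  let S : Set V := {u | D.Reaches v u ∧ D.Reaches u v}
  have hvS : v ∈ S := ⟨.refl, .refl⟩
  have hwS : w ∈ S := ⟨.single hw, hwv⟩
  have hwS' : w' ∈ S := ⟨.single hw', hwv'⟩
  rcases h S ⟨v, rfl⟩ with hS | hS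
  · exact congrArg Subtype.val
      (hS.eq_of_adj (v := ⟨v, hvS⟩) (w := ⟨w, hwS⟩) (w' := ⟨w', hwS'⟩) hw hw')
  · exact absurd hw (hS.2 ⟨v, hvS⟩ ⟨w, hwS⟩)

theorem isDicycle_or_isIsolatedVertex_of_subset [Fintype V] (D : Digraph V) (hD : D.IsSimple)
    (h : D.complementaritySpectrum ⊆ {0, 1}) {S : Set V} (hS : D.IsStrongComponent S) :
    (D.induced S).IsDicycle ∨ (D.induced S).IsIsolatedVertex := by
  classical
  by_contra! hne
  have : Nonempty S := by
    obtain ⟨c, rfl⟩ := hS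
    exact ⟨⟨c, .refl, .refl⟩⟩
  obtain ⟨r, x, hr, hx, hrx⟩ := (D.induced S).exists_pos_eigenvector_one_lt (fun v => hD v)
    hS.reaches_induced hne.1 hne.2
  rcases h (D.mem_complementaritySpectrum_of_induced S hx hrx) with h0 | h1
  · linarith
  · exact hr.ne' h1

end Digraph

theorem mainTheorem3 {V : Type*} [Fintype V] [Nonempty V] (D : Digraph V) (hD : D.IsSimple) :
    List.TFAE [D.complementaritySpectrum = {0},
      D.complementaritySpectrum.ncard = 1,
      D.IsAcyclic] ∧
    List.TFAE [D.complementaritySpectrum = {0, 1},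
      D.complementaritySpectrum.ncard = 2,
      ¬ D.IsAcyclic ∧ ∀ S : Set V, D.IsStrongComponent S →
        (D.induced S).IsDicycle ∨ (D.induced S).IsIsolatedVertex] := by
  have h0 := D.zero_mem_complementaritySpectrum hD
  have hiff := D.complementaritySpectrum_eq_singleton_zero_iff hD
  constructor
  · tfae_have 1 → 2 := fun h => by rw [h, Set.ncard_singleton]
    tfae_have 2 → 1 := fun h => by
      obtain ⟨a, ha⟩ := Set.ncard_eq_one.1 h
      rw [ha] at h0 ⊢
      rw [Set.mem_singleton_iff.1 h0]
    tfae_have 1 ↔ 3 := hiff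
    tfae_finish
  · tfae_have 1 → 2 := fun h => by rw [h, Set.ncard_pair zero_ne_one]
    tfae_have 2 → 3 := fun h => by
      have hc : ¬ D.IsAcyclic := fun hc => by
        rw [hiff.2 hc, Set.ncard_singleton] at h
        omega
      have hsub : {0, 1} ⊆ D.complementaritySpectrum :=
        Set.insert_subset h0 (Set.singleton_subset_iff.2 (D.one_mem_complementaritySpectrum hc))
      -- Infinite sets have `ncard` 0, so the value 2 supplies the finiteness required here.
      have heq := Set.eq_of_subset_of_ncard_le hsub (by rw [h, Set.ncard_pair zero_ne_one])
        (Set.finite_of_ncard_ne_zero (by omega))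
      exact ⟨hc, fun S hS => D.isDicycle_or_isIsolatedVertex_of_subset hD heq.ge hS⟩
    tfae_have 3 → 1 := fun h => D.complementaritySpectrum_eq_zero_one hD h.1 h.2
    tfae_finish
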